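/- Let $n\ge 16$ and let $\mathsf X\subset\mathbb R^n$ be compact and convex. Write $\|\cdot\|$ for the Euclidean norm, $B^n_p$ for the unit ball of $\ell_p$ in $\mathbb R^n$, and $s_{\mathsf X}=\max\{s\ge 0: sB^n_\infty\subseteq \mathsf X\}$. Let $\mathcal F_{\rm Lip}$ be the set of convex functions $f:\mathsf X\to\mathbb R$ with $|f(x)-f(y)|\le\|x-y\|$ for all $x,y\in\mathsf X$. A vector $v$ is called a subgradient of $f\in\mathcal F_{\rm Lip}$ at $x\in\mathsf X$ if $\varphi(y)\ge\varphi(x)+v^{\mathsf T}(y-x)$ for all $y\in\mathbb R^n$, for some convex extension $\varphi:\mathbb R^n\to\mathbb R$ of $f$ that is $L$-Lipschitz for every $L$ for which $f$ is $L$-Lipschitz on $\mathsf X$. Let $(f,x)\mapsto g_f(x)$ be an arbitrary selector of subgradients, measurable in $x$. For $\sigma>0$, the first-order Gaussian (FOG) oracle answers a query $x$ with $Y=(f(x)+W,\;g_f(x)+Z)$ and the subgradient-only Gaussian (SOG) oracle answers with $Y=g_f(x)+Z$, where $W\sim\mathcal N(0,\sigma^2)$ and $Z\sim\mathcal N(0,\sigma^2I_n)$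 are independent of each other, and the noise is fresh at every query. A $T$-step algorithm consists of measurable maps $\mathcal A_t:\mathsf X^{t-1}\times\mathsf Y^{t-1}\to\mathsf X$, $1\le t\le T+1$, where $\mathsf Y$ is the space of oracle responses. It queries $X_t=\mathcal A_t(X^{t-1},Y^{t-1})$, receives the oracle's response $Y_t$ for $t\le T$, and outputs $X_{T+1}=\mathcal A_{T+1}(X^T,Y^T)$. Its error on $f$ is $\operatorname{err}_{\mathcal A}(T,f)=f(X_{T+1})-\inf_{\mathsf X}f$. For $r\ge1$ and $\varepsilon>0$, let $K^{(r)}(\varepsilon)$ be the infimum of all integers $T\ge1$ for which some $T$-step algorithm satisfies $\sup_{f\in\mathcal F_{\rm Lip}}\mathbb E\operatorname{err}_{\mathcal A}(T,f)^r<\varepsilon$ (with $\inf\emptyset=+\infty$). Then there is a universal constant $c>0$ such that for all $n\ge16$, $\rho>0$, $\sigma>0$, $r\ge1$, all $0<\varepsilon\le\bigl(s_{\mathsf X}\sqrt{n/8}\bigr)^r$, and every subgradient selector: - if $\mathsf X=\rho B^n_\infty$, then $$K^{(r)}(\varepsilon)\ \ge\ c\,\frac{n^2\rho^2}{1+n\rho^2}\cdot\frac{\sigma^2}{\varepsilon^{2/r}}\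 \text{ (FOG)},\qquad K^{(r)}(\varepsilon)\ \ge\ c\,n^2\rho^2\cdot\frac{\sigma^2}{\varepsilon^{2/r}}\ \text{ (SOG)};$$ - if $\mathsf X=\rho B^n_2$, then $$K^{(r)}(\varepsilon)\ \ge\ c\,\frac{n\rho^2}{1+\rho^2}\cdot\frac{\sigma^2}{\varepsilon^{2/r}}\ \text{ (FOG)},\qquad K^{(r)}(\varepsilon)\ \ge\ c\,n\rho^2\cdot\frac{\sigma^2}{\varepsilon^{2/r}}\ \text{ (SOG)}.$$ -/

import Mathlib

open MeasureTheory ProbabilityTheory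
open scoped NNReal ENNReal

noncomputable section

/-- A deterministic `T`-step algorithm with queries in `X` and oracle responses in `Y`. The map
`query t` turns the past `(X₁,Y₁), …, (X_t,Y_t)` into the next point; `query 0, …, query (T - 1)`
produce the `T` oracle queries and `query T` produces the candidate minimizer. -/
structure Algorithm (X Y : Type) [MeasurableSpace X] [MeasurableSpace Y] (T : ℕ) where
  query : (t : ℕ) → t ≤ T → (Fin t → X × Y) → X
  measurable_query : ∀ (t : ℕ) (ht : t ≤ T), Measurable (query t ht)

/-- The law of `(X₁,Y₁), …, (X_t,Y_t)` when the algorithm interacts with an oracle whose response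
to a query `x` is drawn from `P x`. -/
def historyLaw {X Y : Type} [MeasurableSpace X] [MeasurableSpace Y] {T : ℕ}
    (A : Algorithm X Y T) (P : Kernel X Y) : (t : ℕ) → t ≤ T → Measure (Fin t → X × Y)
  | 0, _ => Measure.dirac Fin.elim0
  | t + 1, ht =>
    (historyLaw A P t (Nat.le_of_succ_le ht) ⊗ₘ
      P.comap (A.query t (Nat.le_of_succ_le ht))
        (A.measurable_query t (Nat.le_of_succ_le ht))).map
      (fun p => Fin.snoc (α := fun _ => X × Y) p.1
        (A.query t (Nat.le_of_succ_le ht) p.1, p.2))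

/-- The error `f x - f^*`, with `f^*` the infimum of `f` over its domain. -/
def optError {X : Type} (f : X → ℝ) (x : X) : ℝ := f x - ⨅ y, f y

/-- The expected `r`-th power of the error of the output `X_{T+1}` of `A` on the instance `f`. -/
def expectedError {X Y : Type} [MeasurableSpace X] [MeasurableSpace Y] {T : ℕ}
    (A : Algorithm X Y T) (P : Kernel X Y) (f : X → ℝ) (r : ℝ) : ℝ≥0∞ :=
  ∫⁻ h, ENNReal.ofReal (optError f (A.query T le_rfl h) ^ r) ∂(historyLaw A P T le_rfl)

/-- The `r`-th order `ε`-complexity of the problem class with domain `X`, instance space `F` and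
oracle `P`, where `P f x` is the law of the response to the query `x` when the instance is `f`:
the least `T ≥ 1` such that some `T`-step algorithm has worst-case expected `r`-th power error
smaller than `ε` (and `⊤` if there is none). -/
def complexity {X Y : Type} [MeasurableSpace X] [MeasurableSpace Y]
    (F : Set (X → ℝ)) (P : F → Kernel X Y) (r ε : ℝ) : ℕ∞ :=
  sInf {K : ℕ∞ | ∃ T : ℕ, K = T ∧ 1 ≤ T ∧ ∃ A : Algorithm X Y T,
    ⨆ f : F, expectedError A (P f) f r < ENNReal.ofReal ε}

/-- The convex `1`-Lipschitz functions on `X`, for the Euclidean norm. -/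
def lipClass {n : ℕ} (X : Set (EuclideanSpace ℝ (Fin n))) : Set (X → ℝ) :=
  {f | (∃ φ : EuclideanSpace ℝ (Fin n) → ℝ, ConvexOn ℝ X φ ∧ X.domRestrict φ = f) ∧
    LipschitzWith 1 f}

/-- The subdifferential of a function on `ℝⁿ`. -/
def subdifferential {n : ℕ} (φ : EuclideanSpace ℝ (Fin n) → ℝ)
    (x : EuclideanSpace ℝ (Fin n)) : Set (EuclideanSpace ℝ (Fin n)) :=
  {v | ∀ y, φ x + inner ℝ v (y - x) ≤ φ y}

/-- `v` is a subgradient at `x` of the function `f` on `X`: the subgradient inequality holds on all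
of `ℝⁿ` for some convex extension of `f` whose Lipschitz constant is no larger than that of `f`.
(This amounts to the subgradient inequality on `X` together with `‖v‖ ≤ Lip f`, which is
automatic in the interior of `X` and excludes arbitrarily large normal vectors on the boundary.) -/
def IsSubgradient {n : ℕ} {X : Set (EuclideanSpace ℝ (Fin n))} (f : X → ℝ) (x : X)
    (v : EuclideanSpace ℝ (Fin n)) : Prop :=
  ∃ φ : EuclideanSpace ℝ (Fin n) → ℝ, ConvexOn ℝ Set.univ φ ∧ X.domRestrict φ = f ∧
    (∀ L : ℝ≥0, LipschitzWith L f → LipschitzWith L φ) ∧ v ∈ subdifferential φ x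

/-- A selector `(f, x) ↦ g(x) ∈ ∂f(x)` on the Lipschitz class. -/
structure SubgradientSelector {n : ℕ} (X : Set (EuclideanSpace ℝ (Fin n))) where
  toFun : lipClass X → X → EuclideanSpace ℝ (Fin n)
  measurable_toFun : ∀ f, Measurable (toFun f)
  isSubgradient : ∀ f x, IsSubgradient f.1 x (toFun f x)

/-- The centered Gaussian law on `ℝⁿ` with covariance matrix `σ² Iₙ`. -/
def gaussianNoise (n : ℕ) (σ : ℝ≥0) : Measure (EuclideanSpace ℝ (Fin n)) :=
  (Measure.pi fun _ : Fin n => gaussianReal 0 (σ ^ 2)).map (WithLp.toLp 2)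

/-- The first-order Gaussian oracle `Y = (f(x) + W, g(x) + Z)`, with independent
`W ∼ N(0, σ²)` and `Z ∼ N(0, σ² Iₙ)`. -/
def fogOracle {n : ℕ} {X : Set (EuclideanSpace ℝ (Fin n))} (g : SubgradientSelector X) (σ : ℝ≥0)
    (f : lipClass X) : Kernel X (ℝ × EuclideanSpace ℝ (Fin n)) :=
  (Kernel.id ×ₖ Kernel.const X ((gaussianReal 0 (σ ^ 2)).prod (gaussianNoise n σ))).map
    (fun p => (f.1 p.1 + p.2.1, g.toFun f p.1 + p.2.2))

/-- The subgradient-only Gaussian oracle `Y = g(x) + Z`, with `Z ∼ N(0, σ² Iₙ)`. -/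
def sogOracle {n : ℕ} {X : Set (EuclideanSpace ℝ (Fin n))} (g : SubgradientSelector X) (σ : ℝ≥0)
    (f : lipClass X) : Kernel X (EuclideanSpace ℝ (Fin n)) :=
  (Kernel.id ×ₖ Kernel.const X (gaussianNoise n σ)).map (fun p => g.toFun f p.1 + p.2)

/-- The cube `ρ B^n_∞`. -/
def cube (n : ℕ) (ρ : ℝ) : Set (EuclideanSpace ℝ (Fin n)) := {x | ∀ i, |x i| ≤ ρ}

/-- The Euclidean ball `ρ B^n_2`. -/
def euclBall (n : ℕ) (ρ : ℝ) : Set (EuclideanSpace ℝ (Fin n)) := {x | ‖x‖ ≤ ρ}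

/-- The largest `s ≥ 0` such that `s B^n_∞ ⊆ X`. -/
def cubeRadius {n : ℕ} (X : Set (EuclideanSpace ℝ (Fin n))) : ℝ :=
  sSup {s : ℝ | 0 ≤ s ∧ cube n s ⊆ X}

end

/-! The hard instances are `f_θ(x) = δ‖x - sθ‖₁`, with `θ` ranging over all `2 ^ n` sign vectors;
`f_θ` is minimized at the vertex `sθ` with value `0`. With `η = ε ^ (1 / r)`, the slope is fixed by
`δ n s = 5η/2`, so error `η` means that the output lies within `2n/5` of `θ` in the scaled distance
`‖x - sθ‖₁ / s`. A single point can do this for only an exponentially small fraction of the `θ`.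

Information is measured by a chi-square type inequality, `SqDominated`. It multiplies along the
steps of an adaptive interaction, so the histories under any two instances are comparable with
constant `exp (T D)`, where `exp D` bounds one Gaussian response. Here `D` is at most `4δ²n/σ²` for
SOG, with a further `4δ²n²s²/σ²` from the function value for FOG (`norm_selector_sub_le`,
`sq_lipInstance_sub_le`).

Apply it to `F = exp (3/10 * (n - f_θ/(δs)))`, comparing each instance with one fixed reference.
Small error forces the mean of `F` under `θ` to be at least `exp (9n/50)`
(`exp_neg_le_lintegral_exp_neg`). Under the reference the output law no longer depends on `θ`, and
the average over `θ` of `F²` is at most `exp (9n/50)` pointwise (`sum_exp_le`). Hence `TD ≥ 9n/50`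
(`le_horizon_mul`), and substituting `δ` gives both rates. -/

/-- `μ` is dominated by `ν` in the `L²` sense with constant `C`; for `μ ≪ ν` this says that
`∫ (dμ/dν)² dν ≤ C`. -/
def SqDominated {α : Type*} [MeasurableSpace α] (C : ℝ≥0∞) (μ ν : Measure α) : Prop :=
  ∀ F : α → ℝ≥0∞, Measurable F → (∫⁻ x, F x ∂μ) ^ 2 ≤ C * ∫⁻ x, F x ^ 2 ∂ν

/-! ### Calculus of chi-square domination -/

namespace SqDominated

variable {α β : Type*} [MeasurableSpace α] [MeasurableSpace β] {C C' : ℝ≥0∞} {μ ν : Measure α}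

theorem mono (h : SqDominated C μ ν) (hC : C ≤ C') : SqDominated C' μ ν :=
  fun F hF => (h F hF).trans (by gcongr)

theorem map (h : SqDominated C μ ν) {f : α → β} (hf : Measurable f) :
    SqDominated C (μ.map f) (ν.map f) := by
  intro F hF
  rw [lintegral_map hF hf, lintegral_map (by fun_prop) hf]
  exact h _ (hF.comp hf)

/-- Chain rule: domination of the kernels bounds the squared inner integral, and domination of the
base measures handles the outer one. -/
theorem compProd [SFinite μ] [SFinite ν] {κ η : Kernel α β} [IsSFiniteKernel κ]
    [IsSFiniteKernel η] (h : SqDominated C μ ν) (h' : ∀ x, SqDominated C' (κ x) (η x)) :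
    SqDominated (C * C') (μ ⊗ₘ κ) (ν ⊗ₘ η) := by
  intro F hF
  rw [Measure.lintegral_compProd hF, Measure.lintegral_compProd (by fun_prop)]
  calc (∫⁻ a, ∫⁻ b, F (a, b) ∂κ a ∂μ) ^ 2
      ≤ C * ∫⁻ a, (∫⁻ b, F (a, b) ∂κ a) ^ 2 ∂ν := h _ hF.lintegral_kernel_prod_right'
    _ ≤ C * ∫⁻ a, C' * ∫⁻ b, F (a, b) ^ 2 ∂η a ∂ν := by
        gcongr with a
        exact h' a _ (by fun_prop)
    _ = C * C' * ∫⁻ a, ∫⁻ b, F (a, b) ^ 2 ∂η a ∂ν := by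
        rw [lintegral_const_mul, mul_assoc]
        exact (hF.pow_const 2).lintegral_kernel_prod_right'

theorem prod [SFinite μ] [SFinite ν] {μ' ν' : Measure β} [SFinite μ'] [SFinite ν']
    (h : SqDominated C μ ν) (h' : SqDominated C' μ' ν') :
    SqDominated (C * C') (μ.prod μ') (ν.prod ν') := by
  rw [← Measure.compProd_const, ← Measure.compProd_const]
  exact h.compProd fun _ => h'

theorem refl [IsProbabilityMeasure μ] : SqDominated 1 μ μ := by
  intro F hF
  have h := ENNReal.lintegral_mul_le_Lp_mul_Lq μ Real.HolderConjugate.two_two hF.aemeasurable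
    (aemeasurable_const (b := (1 : ℝ≥0∞)))
  simp only [Pi.mul_apply, mul_one, ENNReal.one_rpow, lintegral_one, measure_univ] at h
  calc _ ≤ ((∫⁻ x, F x ^ (2 : ℝ) ∂μ) ^ (1 / 2 : ℝ)) ^ 2 := by gcongr
    _ = _ := by
      rw [← ENNReal.rpow_natCast, ← ENNReal.rpow_mul]
      norm_num

theorem withDensity {L : α → ℝ≥0∞} (hL : Measurable L) (h : ∫⁻ x, L x ^ 2 ∂ν ≤ C) :
    SqDominated C (ν.withDensity L) ν := by
  intro F hF
  rw [lintegral_withDensity_eq_lintegral_mul _ hL hF]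
  have h' := ENNReal.lintegral_mul_le_Lp_mul_Lq ν Real.HolderConjugate.two_two hL.aemeasurable
    hF.aemeasurable
  calc _ ≤ ((∫⁻ x, L x ^ (2 : ℝ) ∂ν) ^ (1 / 2 : ℝ) * (∫⁻ x, F x ^ (2 : ℝ) ∂ν) ^ (1 / 2 : ℝ)) ^ 2 := by
        gcongr
    _ = (∫⁻ x, L x ^ 2 ∂ν) * ∫⁻ x, F x ^ 2 ∂ν := by
        rw [mul_pow, ← ENNReal.rpow_natCast, ← ENNReal.rpow_natCast, ← ENNReal.rpow_mul,
          ← ENNReal.rpow_mul]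
        norm_num
    _ ≤ _ := by gcongr

theorem pi {n : ℕ} {α : Fin n → Type*} [∀ i, MeasurableSpace (α i)] {C : Fin n → ℝ≥0∞}
    {μ ν : ∀ i, Measure (α i)} [∀ i, IsProbabilityMeasure (μ i)]
    [∀ i, IsProbabilityMeasure (ν i)] (h : ∀ i, SqDominated (C i) (μ i) (ν i)) :
    SqDominated (∏ i, C i) (Measure.pi μ) (Measure.pi ν) := by
  induction n with
  | zero =>
    rw [Finset.univ_eq_empty, Finset.prod_empty, Subsingleton.elim μ ν]
    exact refl
  | succ n ih =>
    have key := ((h 0).prod (ih fun i => h i.succ)).map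
      (MeasurableEquiv.piFinSuccAbove α 0).symm.measurable
    have e₁ := (measurePreserving_piFinSuccAbove μ 0).symm.map_eq
    have e₂ := (measurePreserving_piFinSuccAbove ν 0).symm.map_eq
    simp only [Fin.succAbove_zero] at e₁ e₂
    rw [Fin.prod_univ_succ, ← e₁, ← e₂]
    exact key

theorem gaussianReal (a b : ℝ) {v : ℝ≥0} (hv : v ≠ 0) :
    SqDominated (ENNReal.ofReal (Real.exp ((a - b) ^ 2 / v))) (gaussianReal a v)
      (gaussianReal b v) := by
  have hv' : (v : ℝ) ≠ 0 := by exact_mod_cast hv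
  -- The likelihood ratio of `N(a, v)` to `N(b, v)`.
  set L : ℝ → ℝ≥0∞ := fun y => ENNReal.ofReal (Real.exp ((a - b) * (2 * y - a - b) / (2 * v)))
    with hLdef
  have hL : Measurable L := by fun_prop
  have h₁ : ProbabilityTheory.gaussianReal a v
      = (ProbabilityTheory.gaussianReal b v).withDensity L := by
    rw [gaussianReal_of_var_ne_zero _ hv, gaussianReal_of_var_ne_zero _ hv,
      ← withDensity_mul _ (measurable_gaussianPDF _ _) hL]
    congr 1
    ext y
    simp only [Pi.mul_apply, gaussianPDF, gaussianPDFReal, hLdef]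
    rw [← ENNReal.ofReal_mul (by positivity), mul_assoc (_)⁻¹, ← Real.exp_add]
    congr 3
    field_simp
    ring
  rw [h₁]
  apply withDensity hL
  rw [gaussianReal_of_var_ne_zero _ hv, lintegral_withDensity_eq_lintegral_mul _
    (measurable_gaussianPDF _ _) (by fun_prop)]
  -- Completing the square: the density of `N(b, v)` times `L²` is a multiple of the density of
  -- `N(2a - b, v)`.
  calc _ = ∫⁻ y, ENNReal.ofReal (Real.exp ((a - b) ^ 2 / v)) * gaussianPDF (2 * a - b) v y := by
        congr 1 with y
        simp only [Pi.mul_apply, gaussianPDF, gaussianPDFReal, hLdef]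
        rw [← ENNReal.ofReal_pow (by positivity), ← ENNReal.ofReal_mul (by positivity),
          ← ENNReal.ofReal_mul (by positivity), mul_assoc, ← Real.exp_nat_mul, ← Real.exp_add,
          mul_left_comm, ← Real.exp_add]
        congr 3
        field_simp
        push_cast
        ring
    _ ≤ _ := by
        rw [lintegral_const_mul _ (measurable_gaussianPDF _ _), lintegral_gaussianPDF_eq_one _ hv,
          mul_one]

theorem gaussianNoise {n : ℕ} {σ : ℝ≥0} (hσ : σ ≠ 0) (a b : EuclideanSpace ℝ (Fin n)) :
    SqDominated (ENNReal.ofReal (Real.exp (‖a - b‖ ^ 2 / σ ^ 2)))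
      ((gaussianNoise n σ).map (a + ·)) ((gaussianNoise n σ).map (b + ·)) := by
  have key : ∀ a : EuclideanSpace ℝ (Fin n), (_root_.gaussianNoise n σ).map (a + ·)
      = (Measure.pi fun i => ProbabilityTheory.gaussianReal (a i) (σ ^ 2)).map
        (WithLp.toLp 2) := by
    intro a
    have h := Measure.pi_map_pi (μ := fun _ : Fin n => ProbabilityTheory.gaussianReal 0 (σ ^ 2))
      (f := fun i x => a i + x) (fun i => by fun_prop)
    simp only [gaussianReal_map_const_add, zero_add] at h
    rw [_root_.gaussianNoise, Measure.map_map (by fun_prop) (by fun_prop), ← h,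
      Measure.map_map (by fun_prop) (by fun_prop)]
    congr 1
  rw [key, key]
  have h := (pi fun i => gaussianReal (a i) (b i) (pow_ne_zero 2 hσ)).map
    (WithLp.measurable_toLp 2 (Fin n → ℝ))
  refine h.mono (le_of_eq ?_)
  rw [← ENNReal.ofReal_prod_of_nonneg fun i _ => by positivity, ← Real.exp_sum,
    ← Finset.sum_div, EuclideanSpace.norm_eq, Real.sq_sqrt (by positivity)]
  simp [sq_abs]

end SqDominated

instance {n : ℕ} {σ : ℝ≥0} : IsProbabilityMeasure (gaussianNoise n σ) :=
  Measure.isProbabilityMeasure_map (by fun_prop)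

/-! ### One oracle response -/

section Oracle

variable {n : ℕ} {X : Set (EuclideanSpace ℝ (Fin n))} (g : SubgradientSelector X) (σ : ℝ≥0)

theorem measurable_of_mem_lipClass (f : lipClass X) : Measurable f.1 :=
  f.2.2.continuous.measurable

theorem measurable_fog (f : lipClass X) :
    Measurable fun p : X × ℝ × EuclideanSpace ℝ (Fin n) => (f.1 p.1 + p.2.1, g.toFun f p.1 + p.2.2) := by
  have := measurable_of_mem_lipClass f
  have := g.measurable_toFun f
  fun_prop

theorem measurable_sog (f : lipClass X) :
    Measurable fun p : X × EuclideanSpace ℝ (Fin n) => g.toFun f p.1 + p.2 := by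
  have := g.measurable_toFun f
  fun_prop

instance (f : lipClass X) : IsMarkovKernel (fogOracle g σ f) :=
  Kernel.IsMarkovKernel.map _ (measurable_fog g f)

instance (f : lipClass X) : IsMarkovKernel (sogOracle g σ f) :=
  Kernel.IsMarkovKernel.map _ (measurable_sog g f)

theorem sogOracle_apply (f : lipClass X) (x : X) :
    sogOracle g σ f x = (gaussianNoise n σ).map (g.toFun f x + ·) := by
  rw [sogOracle, Kernel.map_apply _ (measurable_sog g f), Kernel.prod_apply, Kernel.id_apply,
    Kernel.const_apply, Measure.dirac_prod, Measure.map_map (measurable_sog g f) (by fun_prop)]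
  rfl

theorem fogOracle_apply (f : lipClass X) (x : X) :
    fogOracle g σ f x = ((gaussianReal (f.1 x) (σ ^ 2)).prod
      ((gaussianNoise n σ).map (g.toFun f x + ·))) := by
  rw [fogOracle, Kernel.map_apply _ (measurable_fog g f), Kernel.prod_apply, Kernel.id_apply,
    Kernel.const_apply, Measure.dirac_prod, Measure.map_map (measurable_fog g f) (by fun_prop)]
  have h := gaussianReal_map_const_add (μ := 0) (v := σ ^ 2) (f.1 x)
  rw [zero_add] at h
  rw [← h, Measure.map_prod_map _ _ (by fun_prop) (by fun_prop)]
  rfl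

variable {σ}

theorem SqDominated.sogOracle (hσ : σ ≠ 0) {f f' : lipClass X} {B : ℝ} (x : X)
    (hg : ‖g.toFun f x - g.toFun f' x‖ ^ 2 ≤ B) :
    SqDominated (ENNReal.ofReal (Real.exp (B / σ ^ 2))) (sogOracle g σ f x)
      (sogOracle g σ f' x) := by
  rw [sogOracle_apply, sogOracle_apply]
  exact (SqDominated.gaussianNoise hσ _ _).mono (by gcongr)

theorem SqDominated.fogOracle (hσ : σ ≠ 0) {f f' : lipClass X} {A B : ℝ} (x : X)
    (hf : (f.1 x - f'.1 x) ^ 2 ≤ A) (hg : ‖g.toFun f x - g.toFun f' x‖ ^ 2 ≤ B) :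
    SqDominated (ENNReal.ofReal (Real.exp ((A + B) / σ ^ 2))) (fogOracle g σ f x)
      (fogOracle g σ f' x) := by
  rw [fogOracle_apply, fogOracle_apply]
  refine ((SqDominated.gaussianReal _ _ (pow_ne_zero 2 hσ)).prod
    (SqDominated.gaussianNoise hσ _ _)).mono ?_
  rw [← ENNReal.ofReal_mul (by positivity), ← Real.exp_add, NNReal.coe_pow, ← add_div]
  gcongr

end Oracle

/-! ### Adaptive histories -/

section History

variable {X Y : Type} [MeasurableSpace X] [MeasurableSpace Y] {T : ℕ} (A : Algorithm X Y T)

theorem measurable_snoc_pair (t : ℕ) {q : (Fin t → X × Y) → X} (hq : Measurable q) :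
    Measurable fun p : (Fin t → X × Y) × Y =>
      (Fin.snoc (α := fun _ => X × Y) p.1 (q p.1, p.2) : Fin (t + 1) → X × Y) := by
  rw [measurable_pi_iff]
  intro i
  refine Fin.lastCases ?_ (fun j => ?_) i
  · simp only [Fin.snoc_last]
    fun_prop
  · simp only [Fin.snoc_castSucc]
    fun_prop

instance isProbabilityMeasure_historyLaw (P : Kernel X Y) [IsMarkovKernel P] (t : ℕ)
    (ht : t ≤ T) : IsProbabilityMeasure (historyLaw A P t ht) := by
  induction t with
  | zero => exact Measure.dirac.isProbabilityMeasure
  | succ t ih =>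
    have := ih (Nat.le_of_succ_le ht)
    exact Measure.isProbabilityMeasure_map
      (measurable_snoc_pair t (A.measurable_query t _)).aemeasurable

/-- The queries are the same function of the past under `P` and `Q`, so each step costs only one
factor `C` from the response, however adaptive the algorithm is. -/
theorem SqDominated.historyLaw {P Q : Kernel X Y} [IsMarkovKernel P] [IsMarkovKernel Q]
    {C : ℝ≥0∞} (h : ∀ x, SqDominated C (P x) (Q x)) (t : ℕ) (ht : t ≤ T) :
    SqDominated (C ^ t) (historyLaw A P t ht) (historyLaw A Q t ht) := by
  induction t with
  | zero =>
    rw [pow_zero]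
    exact SqDominated.refl (μ := _root_.historyLaw A P 0 ht)
  | succ t ih =>
    rw [pow_succ]
    exact ((ih (Nat.le_of_succ_le ht)).compProd fun _ => h _).map
      (measurable_snoc_pair t (A.measurable_query t _))

end History

/-! ### Hard instances: scaled `ℓ₁` distances to cube vertices -/

section Instances

variable {n : ℕ}

/-- The function `δ ‖x - p‖₁`. -/
def scaledL1Dist (δ : ℝ) (p x : EuclideanSpace ℝ (Fin n)) : ℝ := δ * ∑ i, |x i - p i|

theorem sum_abs_le_sqrt_mul_norm (x : EuclideanSpace ℝ (Fin n)) : ∑ i, |x i| ≤ √n * ‖x‖ := by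
  rw [EuclideanSpace.norm_eq, ← Real.sqrt_mul (Nat.cast_nonneg n)]
  apply Real.le_sqrt_of_sq_le
  have h := sq_sum_le_card_mul_sum_sq (s := Finset.univ) (f := fun i => |x i|)
  simpa using h

theorem abs_scaledL1Dist_sub_le {δ : ℝ} (hδ : 0 ≤ δ) (p q x y : EuclideanSpace ℝ (Fin n)) :
    |scaledL1Dist δ p x - scaledL1Dist δ q y| ≤ δ * ∑ i, |(x i - p i) - (y i - q i)| := by
  rw [scaledL1Dist, scaledL1Dist, ← mul_sub, abs_mul, abs_of_nonneg hδ, ← Finset.sum_sub_distrib]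
  gcongr
  exact (Finset.abs_sum_le_sum_abs _ _).trans
    (Finset.sum_le_sum fun i _ => abs_abs_sub_abs_le_abs_sub _ _)

theorem scaledL1Dist_nonneg {δ : ℝ} (hδ : 0 ≤ δ) (p x : EuclideanSpace ℝ (Fin n)) :
    0 ≤ scaledL1Dist δ p x :=
  mul_nonneg hδ (Finset.sum_nonneg fun _ _ => abs_nonneg _)

theorem scaledL1Dist_self (δ : ℝ) (p : EuclideanSpace ℝ (Fin n)) : scaledL1Dist δ p p = 0 := by
  simp [scaledL1Dist]

theorem lipschitzWith_scaledL1Dist (δ : ℝ≥0) (p : EuclideanSpace ℝ (Fin n)) :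
    LipschitzWith (δ * NNReal.sqrt n) (scaledL1Dist δ p) := by
  apply LipschitzWith.of_dist_le_mul
  intro x y
  rw [Real.dist_eq, dist_eq_norm]
  refine (abs_scaledL1Dist_sub_le δ.coe_nonneg p p x y).trans ?_
  simp only [sub_sub_sub_cancel_right]
  push_cast
  rw [mul_assoc]
  gcongr
  exact sum_abs_le_sqrt_mul_norm (x - y)

theorem convexOn_scaledL1Dist {δ : ℝ} (hδ : 0 ≤ δ) (p : EuclideanSpace ℝ (Fin n)) :
    ConvexOn ℝ Set.univ (scaledL1Dist δ p) := by
  refine ⟨convex_univ, fun x _ y _ a b ha hb hab => ?_⟩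
  simp only [scaledL1Dist, smul_eq_mul]
  rw [mul_left_comm a, mul_left_comm b, ← mul_add, Finset.mul_sum _ _ a, Finset.mul_sum _ _ b,
    ← Finset.sum_add_distrib]
  gcongr with i
  calc |(a • x + b • y) i - p i| = |a * (x i - p i) + b * (y i - p i)| := by
        congr 1
        simp only [PiLp.add_apply, PiLp.smul_apply, smul_eq_mul]
        linear_combination (p i) * hab
    _ ≤ |a * (x i - p i)| + |b * (y i - p i)| := abs_add_le _ _
    _ = _ := by rw [abs_mul, abs_mul, abs_of_nonneg ha, abs_of_nonneg hb]

/-- The function `δ ‖x - p‖₁` as an element of the Lipschitz class. -/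
def lipInstance {X : Set (EuclideanSpace ℝ (Fin n))} (hX : Convex ℝ X) (δ : ℝ≥0)
    (hδ : δ * NNReal.sqrt n ≤ 1) (p : EuclideanSpace ℝ (Fin n)) : lipClass X :=
  ⟨X.domRestrict (scaledL1Dist δ p),
    ⟨⟨scaledL1Dist δ p, (convexOn_scaledL1Dist δ.coe_nonneg p).subset (Set.subset_univ _) hX, rfl⟩,
      fun x y => (lipschitzWith_scaledL1Dist δ p).weaken hδ x y⟩⟩

theorem optError_eq_self {X : Type} {f : X → ℝ} (hf : ∀ x, 0 ≤ f x) {x₀ : X} (h : f x₀ = 0)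
    (x : X) : optError f x = f x := by
  have : ⨅ y, f y = 0 := by
    have : Nonempty X := ⟨x₀⟩
    exact le_antisymm (h ▸ ciInf_le ⟨0, by rintro _ ⟨y, rfl⟩; exact hf y⟩ x₀) (le_ciInf hf)
  rw [optError, this, sub_zero]

theorem norm_le_of_mem_subdifferential {φ : EuclideanSpace ℝ (Fin n) → ℝ} {L : ℝ≥0}
    (hφ : LipschitzWith L φ) {x v : EuclideanSpace ℝ (Fin n)} (hv : v ∈ subdifferential φ x) :
    ‖v‖ ≤ L := by
  -- Moving in the direction `v` itself increases `φ` by at least `‖v‖²` and at most `L‖v‖`.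
  have h₁ := hv (x + v)
  have h₂ := (le_abs_self _).trans (hφ.dist_le_mul (x + v) x)
  rw [add_sub_cancel_left, real_inner_self_eq_norm_sq] at h₁
  rw [dist_eq_norm, add_sub_cancel_left] at h₂
  rcases (norm_nonneg v).eq_or_lt with h | h
  · rw [← h]
    exact L.coe_nonneg
  · exact le_of_mul_le_mul_right (by linarith) h

theorem IsSubgradient.norm_le {X : Set (EuclideanSpace ℝ (Fin n))} {f : X → ℝ} {x : X}
    {v : EuclideanSpace ℝ (Fin n)} (h : IsSubgradient f x v) {L : ℝ≥0} (hf : LipschitzWith L f) :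
    ‖v‖ ≤ L := by
  obtain ⟨φ, -, -, hφ, hv⟩ := h
  exact norm_le_of_mem_subdifferential (hφ L hf) hv

/-- Only the size of subgradients enters, each being at most the Lipschitz constant `δ√n`; this
makes the bound uniform over selectors, including at kinks and on the boundary. -/
theorem norm_selector_sub_le {X : Set (EuclideanSpace ℝ (Fin n))} (hX : Convex ℝ X) {δ : ℝ≥0}
    (hδ : δ * NNReal.sqrt n ≤ 1) (g : SubgradientSelector X) (p q : EuclideanSpace ℝ (Fin n))
    (x : X) :
    ‖g.toFun (lipInstance hX δ hδ p) x - g.toFun (lipInstance hX δ hδ q) x‖ ^ 2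
      ≤ 4 * δ ^ 2 * n := by
  have h : ∀ p, ‖g.toFun (lipInstance hX δ hδ p) x‖ ≤ δ * √n := by
    intro p
    have := (g.isSubgradient (lipInstance hX δ hδ p) x).norm_le
      (L := δ * NNReal.sqrt n) fun x y => lipschitzWith_scaledL1Dist δ p x y
    simpa using this
  calc _ ≤ (δ * √n + δ * √n) ^ 2 := by
        gcongr
        exact (norm_sub_le _ _).trans (add_le_add (h p) (h q))
    _ = 4 * δ ^ 2 * √n ^ 2 := by ring
    _ = _ := by rw [Real.sq_sqrt (Nat.cast_nonneg n)]

/-- The vertex `s θ` of the cube of radius `s`, for a vector `θ` of signs. -/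
def cubeVertex (s : ℝ) (θ : Fin n → Bool) : EuclideanSpace ℝ (Fin n) :=
  WithLp.toLp 2 fun i => if θ i then s else -s

theorem abs_cubeVertex {s : ℝ} (hs : 0 ≤ s) (θ : Fin n → Bool) (i : Fin n) :
    |cubeVertex s θ i| = s := by
  simp only [cubeVertex]
  split_ifs <;> simp [abs_of_nonneg hs]

theorem cubeVertex_mem {s : ℝ} (hs : 0 ≤ s) (θ : Fin n → Bool) : cubeVertex s θ ∈ cube n s :=
  fun i => (abs_cubeVertex hs θ i).le

theorem sq_lipInstance_sub_le {X : Set (EuclideanSpace ℝ (Fin n))} (hX : Convex ℝ X) {δ : ℝ≥0}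
    (hδ : δ * NNReal.sqrt n ≤ 1) {s : ℝ} (hs : 0 ≤ s) (θ θ' : Fin n → Bool) (x : X) :
    ((lipInstance hX δ hδ (cubeVertex s θ)).1 x - (lipInstance hX δ hδ (cubeVertex s θ')).1 x) ^ 2
      ≤ 4 * δ ^ 2 * n ^ 2 * s ^ 2 := by
  have h := abs_scaledL1Dist_sub_le δ.coe_nonneg (cubeVertex s θ) (cubeVertex s θ') x.1 x.1
  have h' : ∑ i, |(x.1 i - cubeVertex s θ i) - (x.1 i - cubeVertex s θ' i)| ≤ n * (2 * s) := by
    refine (Finset.sum_le_card_nsmul _ _ (2 * s) fun i _ => ?_).trans_eq (by simp)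
    rw [sub_sub_sub_cancel_left, two_mul]
    exact (abs_sub _ _).trans
      (by rw [abs_cubeVertex hs, abs_cubeVertex hs])
  have h'' := h.trans (mul_le_mul_of_nonneg_left h' δ.coe_nonneg)
  calc _ ≤ (δ * (n * (2 * s))) ^ 2 := sq_le_sq' (abs_le.1 h'').1 (abs_le.1 h'').2
    _ = _ := by ring

end Instances

/-! ### Exponential moments -/

section Moments

/-- A one-sided Hoeffding bound. With `a` the larger number and `m = max a 0 ≤ 1`, one has `b ≤ -m`,
so the sum is at most `2 cosh (lam * m) ≤ 2 cosh lam`. -/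
theorem exp_add_exp_le {lam a b : ℝ} (hlam : 0 ≤ lam) (ha : a ≤ 1) (hb : b ≤ 1)
    (hab : a + b ≤ 0) :
    Real.exp (lam * a) + Real.exp (lam * b) ≤ 2 * Real.exp (lam ^ 2 / 2) := by
  wlog h : b ≤ a generalizing a b
  · rw [add_comm]
    exact this hb ha (by linarith) (by linarith)
  have hcosh := (Real.cosh_le_cosh.2 (show |lam * max a 0| ≤ |lam| by
    rw [abs_mul, abs_of_nonneg (le_max_right a 0)]
    exact mul_le_of_le_one_right (abs_nonneg _) (max_le ha zero_le_one))).trans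
    (Real.cosh_le_exp_half_sq lam)
  rw [Real.cosh_eq] at hcosh
  have h₁ : Real.exp (lam * a) ≤ Real.exp (lam * max a 0) := by
    gcongr
    exact le_max_left _ _
  have h₂ : Real.exp (lam * b) ≤ Real.exp (-(lam * max a 0)) := by
    rw [← mul_neg]
    gcongr
    rcases max_cases a 0 with h | h <;> linarith
  linarith

theorem sum_prod_bool {n : ℕ} (h : Fin n → Bool → ℝ) :
    ∑ θ : Fin n → Bool, ∏ i, h i (θ i) = ∏ i, (h i true + h i false) := by
  have := Finset.prod_univ_sum (fun _ : Fin n => (Finset.univ : Finset Bool)) h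
  simp only [Fintype.piFinset_univ, Fintype.sum_bool] at this
  exact this.symm

/-- The sum factorizes over coordinates. In each one, the two values of `1 - |x i ∓ s| / s` are at
most `1` and, by the triangle inequality, have sum at most `0`. -/
theorem sum_exp_le {n : ℕ} {lam s : ℝ} (hlam : 0 ≤ lam) (hs : 0 < s)
    (x : EuclideanSpace ℝ (Fin n)) :
    ∑ θ : Fin n → Bool, Real.exp (lam * (n - (∑ i, |x i - cubeVertex s θ i|) / s))
      ≤ 2 ^ n * Real.exp (lam ^ 2 / 2 * n) := by
  have h : ∀ θ : Fin n → Bool, Real.exp (lam * (n - (∑ i, |x i - cubeVertex s θ i|) / s))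
      = ∏ i, (fun i b => Real.exp (lam * (1 - |x i - if b then s else -s| / s))) i (θ i) := by
    intro θ
    rw [← Real.exp_sum, ← Finset.mul_sum, Finset.sum_sub_distrib, Finset.sum_div]
    simp [cubeVertex]
  rw [Finset.sum_congr rfl fun θ _ => h θ, sum_prod_bool fun i b =>
    Real.exp (lam * (1 - |x i - if b then s else -s| / s))]
  calc _ ≤ ∏ _i : Fin n, (2 * Real.exp (lam ^ 2 / 2)) := by
        apply Finset.prod_le_prod (fun i _ => by positivity)
        intro i _
        apply exp_add_exp_le hlam
        · linarith [show (0 : ℝ) ≤ |x i - if true then s else -s| / s by positivity]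
        · linarith [show (0 : ℝ) ≤ |x i - if false then s else -s| / s by positivity]
        · have : 2 ≤ |x i - s| / s + |x i + s| / s := by
            rw [← add_div, le_div_iff₀ hs]
            linarith [neg_abs_le (x i - s), le_abs_self (x i + s)]
          simp only [if_true, Bool.false_eq_true, if_false, sub_neg_eq_add]
          linarith
    _ = _ := by
        rw [Finset.prod_const, Finset.card_univ, Fintype.card_fin, mul_pow, ← Real.exp_nat_mul]
        ring_nf

/-- Jensen's inequality by tangent lines at `u = f / η = 1`: the exponential lies above its tangent,
and Bernoulli's inequality replaces `u - 1` by `(u ^ r - 1) / r`. The constant `c` is added to both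
sides so that every integrand is nonnegative. -/
theorem exp_neg_le_lintegral_exp_neg {Ω : Type*} [MeasurableSpace Ω] (μ : Measure Ω)
    [IsProbabilityMeasure μ] {f : Ω → ℝ} (hf : Measurable f) (hf₀ : ∀ x, 0 ≤ f x) {r η a : ℝ}
    (hr : 1 ≤ r) (hη : 0 < η) (ha : 0 ≤ a)
    (h : ∫⁻ x, ENNReal.ofReal (f x ^ r) ∂μ ≤ ENNReal.ofReal (η ^ r)) :
    ENNReal.ofReal (Real.exp (-a)) ≤ ∫⁻ x, ENNReal.ofReal (Real.exp (-a * (f x / η))) ∂μ := by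
  have hηr : 0 < η ^ r := Real.rpow_pos_of_pos hη r
  set c : ℝ := Real.exp (-a) * (a / r)
  have hc : 0 ≤ c := by positivity
  have hpt : ∀ x, Real.exp (-a) + c ≤ Real.exp (-a * (f x / η)) + c / η ^ r * f x ^ r := by
    intro x
    have hu : 0 ≤ f x / η := div_nonneg (hf₀ x) hη.le
    have h₁ := one_add_mul_self_le_rpow_one_add (s := f x / η - 1) (by linarith) hr
    rw [add_sub_cancel, Real.div_rpow (hf₀ x) hη.le] at h₁
    have h₂ : f x / η - 1 ≤ (f x ^ r / η ^ r - 1) / r := by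
      rw [le_div_iff₀ (by linarith)]
      linarith
    have h₃ : Real.exp (-a) * (1 - a * (f x / η - 1)) ≤ Real.exp (-a * (f x / η)) := by
      have := Real.add_one_le_exp (-a * (f x / η - 1))
      calc _ ≤ Real.exp (-a) * Real.exp (-a * (f x / η - 1)) := by gcongr; linarith
        _ = _ := by rw [← Real.exp_add]; ring_nf
    have h₄ : Real.exp (-a) * (a * (f x / η - 1))
        ≤ Real.exp (-a) * (a * ((f x ^ r / η ^ r - 1) / r)) := by gcongr
    have h₅ : c / η ^ r * f x ^ r = Real.exp (-a) * (a * ((f x ^ r / η ^ r - 1) / r)) + c := by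
      simp only [c]
      field_simp
      ring
    linarith
  have hint : ENNReal.ofReal (Real.exp (-a)) + ENNReal.ofReal c
      ≤ ∫⁻ x, ENNReal.ofReal (Real.exp (-a * (f x / η))) ∂μ + ENNReal.ofReal c := by
    calc _ = ∫⁻ _, (ENNReal.ofReal (Real.exp (-a)) + ENNReal.ofReal c) ∂μ := by simp
      _ ≤ ∫⁻ x, (ENNReal.ofReal (Real.exp (-a * (f x / η)))
            + ENNReal.ofReal (c / η ^ r) * ENNReal.ofReal (f x ^ r)) ∂μ := by
          refine lintegral_mono fun x => ?_
          rw [← ENNReal.ofReal_mul (by positivity), ← ENNReal.ofReal_add (by positivity) hc,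
            ← ENNReal.ofReal_add (by positivity)
              (mul_nonneg (by positivity) (Real.rpow_nonneg (hf₀ x) r))]
          exact ENNReal.ofReal_le_ofReal (hpt x)
      _ = ∫⁻ x, ENNReal.ofReal (Real.exp (-a * (f x / η))) ∂μ
            + ENNReal.ofReal (c / η ^ r) * ∫⁻ x, ENNReal.ofReal (f x ^ r) ∂μ := by
          rw [lintegral_add_left (by fun_prop), lintegral_const_mul _ (by fun_prop)]
      _ ≤ ∫⁻ x, ENNReal.ofReal (Real.exp (-a * (f x / η))) ∂μ
            + ENNReal.ofReal (c / η ^ r) * ENNReal.ofReal (η ^ r) := by gcongr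
      _ = _ := by
          rw [← ENNReal.ofReal_mul (by positivity), div_mul_cancel₀ _ hηr.ne']
  exact (ENNReal.add_le_add_iff_right ENNReal.ofReal_ne_top).1 hint

end Moments

/-! ### The lower bound on the horizon -/

section LowerBound

variable {n : ℕ} {X : Set (EuclideanSpace ℝ (Fin n))}

theorem le_horizon_mul {Y : Type} [MeasurableSpace Y] (hX : Convex ℝ X) {δ : ℝ≥0}
    (hδ : δ * NNReal.sqrt n ≤ 1) {s η r D : ℝ} (hs : 0 < s) (hη : 0 < η) (hr : 1 ≤ r)
    (hsX : cube n s ⊆ X) (hn : 0 < n) (hδη : δ * (n * s) = 5 / 2 * η)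
    (P : lipClass X → Kernel X Y) [∀ f, IsMarkovKernel (P f)]
    (hP : ∀ (θ θ' : Fin n → Bool) x, SqDominated (ENNReal.ofReal (Real.exp D))
      (P (lipInstance hX δ hδ (cubeVertex s θ)) x) (P (lipInstance hX δ hδ (cubeVertex s θ')) x))
    {T : ℕ} (A : Algorithm X Y T)
    (hA : ⨆ f : lipClass X, expectedError A (P f) f.1 r < ENNReal.ofReal (η ^ r)) :
    9 / 50 * n ≤ T * D := by
  set I : (Fin n → Bool) → lipClass X := fun θ => lipInstance hX δ hδ (cubeVertex s θ) with hI
  set out : (Fin T → X × Y) → X := A.query T le_rfl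
  have hout : Measurable out := A.measurable_query T le_rfl
  have hn' : (0 : ℝ) < n := by exact_mod_cast hn
  have hδ0 : (0 : ℝ) < δ := by
    refine pos_of_mul_pos_left (b := (n * s : ℝ)) ?_ (by positivity)
    rw [hδη]
    positivity
  have hIm : ∀ θ, Measurable (I θ).1 := fun θ => measurable_of_mem_lipClass _
  -- The factor `3/10` is half of `lam = 3/5`, since domination squares the test function. This
  -- `lam` maximizes `3/5 * lam - lam ^ 2 / 2`, where `3/5 = 1 - 2/5` is the mean gain per
  -- coordinate; the maximum is `9/50`.
  set G : (Fin n → Bool) → X → ℝ := fun θ x => 3 / 10 * (n - (I θ).1 x / (δ * s)) with hG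
  have hGm : ∀ θ, Measurable (G θ) := fun θ => by
    have := hIm θ
    simp only [hG]
    fun_prop
  set Q := historyLaw A (P (I fun _ => true)) T le_rfl
  have lower : ∀ θ, ENNReal.ofReal (Real.exp (9 / 50 * n))
      ≤ ∫⁻ h, ENNReal.ofReal (Real.exp (G θ (out h))) ∂(historyLaw A (P (I θ)) T le_rfl) := by
    intro θ
    have hnonneg : ∀ x, 0 ≤ (I θ).1 x := fun x => scaledL1Dist_nonneg δ.coe_nonneg _ _
    have herr := (le_iSup (fun f : lipClass X => expectedError A (P f) f.1 r) (I θ)).trans hA.le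
    simp only [expectedError] at herr
    have hzero : (I θ).1 ⟨cubeVertex s θ, hsX (cubeVertex_mem hs.le θ)⟩ = 0 :=
      scaledL1Dist_self _ _
    simp only [optError_eq_self hnonneg hzero] at herr
    -- Since `η = 2/5 * n * δ * s`, the term `3/10 * f_θ/(δs)` equals `a * f_θ/η` with `a = 3/10 *
    -- 2/5 * n`.
    have key := exp_neg_le_lintegral_exp_neg (historyLaw A (P (I θ)) T le_rfl)
      ((hIm θ).comp hout) (fun h => hnonneg _) hr hη (a := 3 / 25 * n) (by positivity) herr
    have hexp : ∀ h, ENNReal.ofReal (Real.exp (G θ (out h)))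
        = ENNReal.ofReal (Real.exp (3 / 10 * n)) *
          ENNReal.ofReal (Real.exp (-(3 / 25 * n) * (((I θ).1 ∘ out) h / η))) := by
      intro h
      rw [← ENNReal.ofReal_mul (by positivity), ← Real.exp_add]
      congr 2
      have h1 : (n : ℝ) / η = 5 / 2 / (δ * s) := by
        field_simp
        linarith
      simp only [hG, Function.comp]
      linear_combination (3 / 25 * (I θ).1 (out h)) * h1
    simp_rw [hexp]
    rw [lintegral_const_mul]
    · refine le_trans (le_of_eq ?_) (mul_le_mul_right key _)
      rw [← ENNReal.ofReal_mul (by positivity), ← Real.exp_add]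
      congr 2
      ring
    · have := (hIm θ).comp hout
      fun_prop
  have step : ∀ θ, ENNReal.ofReal (Real.exp (9 / 25 * n))
      ≤ ENNReal.ofReal (Real.exp (T * D)) *
        ∫⁻ h, ENNReal.ofReal (Real.exp (3 / 5 * (n - (I θ).1 (out h) / (δ * s)))) ∂Q := by
    intro θ
    have hdom := SqDominated.historyLaw A (P := P (I θ)) (Q := P (I fun _ => true))
      (fun x => hP θ (fun _ => true) x) T le_rfl
      (fun h => ENNReal.ofReal (Real.exp (G θ (out h)))) (by have := (hGm θ).comp hout; fun_prop)
    calc ENNReal.ofReal (Real.exp (9 / 25 * n))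
        = ENNReal.ofReal (Real.exp (9 / 50 * n)) ^ 2 := by
          rw [← ENNReal.ofReal_pow (by positivity), ← Real.exp_nat_mul]
          congr 2
          push_cast
          ring
      _ ≤ _ := by gcongr; exact lower θ
      _ ≤ _ := hdom
      _ = _ := by
          rw [← ENNReal.ofReal_pow (by positivity), ← Real.exp_nat_mul]
          congr 2 with h
          rw [← ENNReal.ofReal_pow (by positivity), ← Real.exp_nat_mul]
          congr 2
          simp only [hG]
          push_cast
          ring
  have upper : ∑ θ, ∫⁻ h, ENNReal.ofReal (Real.exp (3 / 5 * (n - (I θ).1 (out h) / (δ * s)))) ∂Q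
      ≤ ENNReal.ofReal (2 ^ n * Real.exp (9 / 50 * n)) := by
    rw [← lintegral_finsetSum]
    · calc _ ≤ ∫⁻ _, ENNReal.ofReal (2 ^ n * Real.exp (9 / 50 * n)) ∂Q := by
            gcongr with h
            rw [← ENNReal.ofReal_sum_of_nonneg fun θ _ => by positivity]
            apply ENNReal.ofReal_le_ofReal
            refine (le_of_eq ?_).trans ((sum_exp_le (n := n) (lam := 3 / 5) (by norm_num) hs
              (out h).1).trans_eq ?_)
            · refine Finset.sum_congr rfl fun θ _ => ?_
              simp only [hI, lipInstance, Set.domRestrict_apply, scaledL1Dist]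
              rw [mul_div_mul_left _ _ hδ0.ne']
            · ring_nf
        _ = _ := by simp
    · intro θ _
      have := (hIm θ).comp hout
      fun_prop
  have total : ENNReal.ofReal (2 ^ n * Real.exp (9 / 25 * n))
      ≤ ENNReal.ofReal (Real.exp (T * D)) * ENNReal.ofReal (2 ^ n * Real.exp (9 / 50 * n)) := by
    calc _ = ∑ _θ : Fin n → Bool, ENNReal.ofReal (Real.exp (9 / 25 * n)) := by
          rw [Finset.sum_const, Finset.card_univ, Fintype.card_fun, Fintype.card_bool,
            Fintype.card_fin, nsmul_eq_mul, ENNReal.ofReal_mul (by positivity)]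
          congr 1
          rw [ENNReal.ofReal_pow (by norm_num)]
          simp
      _ ≤ _ := Finset.sum_le_sum fun θ _ => step θ
      _ = _ := (Finset.mul_sum _ _ _).symm
      _ ≤ _ := by gcongr
  rw [← ENNReal.ofReal_mul (by positivity), ENNReal.ofReal_le_ofReal_iff (by positivity),
    mul_left_comm, mul_le_mul_iff_right₀ (by positivity), ← Real.exp_add, Real.exp_le_exp] at total
  linarith

theorem ofReal_le_complexity {X Y : Type} [MeasurableSpace X] [MeasurableSpace Y]
    {F : Set (X → ℝ)} {P : F → Kernel X Y} {r ε b : ℝ}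
    (h : ∀ (T : ℕ) (A : Algorithm X Y T),
      ⨆ f : F, expectedError A (P f) f r < ENNReal.ofReal ε → b ≤ T) :
    ENNReal.ofReal b ≤ (complexity F P r ε : ℝ≥0∞) := by
  rw [complexity]
  set S : Set ℕ∞ := {K : ℕ∞ | ∃ T : ℕ, K = T ∧ 1 ≤ T ∧ ∃ A : Algorithm X Y T,
    ⨆ f : F, expectedError A (P f) f r < ENNReal.ofReal ε}
  rcases S.eq_empty_or_nonempty with hS | hS
  · simp [hS]
  · obtain ⟨T, hT, -, A, hA⟩ := csInf_mem hS
    rw [hT]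
    have := ENNReal.ofReal_le_ofReal (h T A hA)
    simpa using this

/-- The step size of the hard instances meets the Lipschitz constraint. -/
theorem exists_slope {s η : ℝ} (hs : 0 < s) (hη : 0 < η) (hn : 0 < n)
    (h : η ≤ s * √((n : ℝ) / 8)) :
    ∃ δ : ℝ≥0, δ * NNReal.sqrt n ≤ 1 ∧ δ * (n * s) = 5 / 2 * η := by
  have hn' : (0 : ℝ) < n := by exact_mod_cast hn
  obtain ⟨δ, hδ⟩ : ∃ δ : ℝ≥0, (δ : ℝ) = 5 / 2 * η / (n * s) :=
    CanLift.prf (5 / 2 * η / (n * s)) (by positivity)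
  refine ⟨δ, ?_, ?_⟩
  · rw [← NNReal.coe_le_coe]
    push_cast
    rw [hδ]
    -- Here `(5/2)² / 8 = 25/32 ≤ 1`: this is where the constant `8` in the range of `ε` suffices.
    have h8 : 5 / 2 * √((n : ℝ) / 8) ≤ √n := by
      apply Real.le_sqrt_of_sq_le
      rw [mul_pow, Real.sq_sqrt (by positivity)]
      linarith
    rw [div_mul_eq_mul_div, div_le_one (by positivity)]
    calc 5 / 2 * η * √n ≤ 5 / 2 * (s * √((n : ℝ) / 8)) * √n := by gcongr
      _ = (5 / 2 * √((n : ℝ) / 8)) * √n * s := by ring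
      _ ≤ √n * √n * s := by gcongr
      _ = n * s := by rw [Real.mul_self_sqrt hn'.le]
  · rw [hδ]
    field_simp

variable {s r ε : ℝ} {σ : ℝ≥0}

/-- Passing from `ε` to `η = ε ^ (1 / r)`. -/
theorem exists_rpow_eq {b : ℝ} (hr : 0 < r) (hε : 0 < ε) (hb : 0 ≤ b) (h : ε ≤ b ^ r) :
    ∃ η : ℝ, 0 < η ∧ η ^ r = ε ∧ η ≤ b ∧ ε ^ (2 / r) = η ^ 2 := by
  refine ⟨ε ^ (1 / r), by positivity, ?_, ?_, ?_⟩
  · rw [← Real.rpow_mul hε.le, one_div_mul_cancel hr.ne', Real.rpow_one]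
  · refine (Real.rpow_le_rpow hε.le h (by positivity)).trans_eq ?_
    rw [← Real.rpow_mul hb, mul_one_div_cancel hr.ne', Real.rpow_one]
  · rw [← Real.rpow_natCast, ← Real.rpow_mul hε.le]
    congr 1
    push_cast
    ring

theorem le_complexity_fog (hX : Convex ℝ X) (hs : 0 < s) (hsX : cube n s ⊆ X) (hn : 0 < n)
    (hσ : 0 < σ) (hr : 1 ≤ r) (hε : 0 < ε) (h : ε ≤ (s * √((n : ℝ) / 8)) ^ r)
    (g : SubgradientSelector X) :
    ENNReal.ofReal (9 / 1250 * ((n : ℝ) ^ 2 * s ^ 2 / (1 + n * s ^ 2) *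
        ((σ : ℝ) ^ 2 / ε ^ (2 / r)))) ≤
      (complexity (lipClass X) (fogOracle g σ) r ε : ℝ≥0∞) := by
  have hr0 : 0 < r := by linarith
  obtain ⟨η, hη, rfl, hηs, hη2⟩ := exists_rpow_eq hr0 hε (by positivity) h
  obtain ⟨δ, hδ, hδη⟩ := exists_slope hs hη hn hηs
  rw [hη2]
  refine ofReal_le_complexity fun T A hA => ?_
  have key := le_horizon_mul hX hδ hs hη hr hsX hn hδη (fogOracle g σ)
    (fun θ θ' x => SqDominated.fogOracle g hσ.ne' x (sq_lipInstance_sub_le hX hδ hs.le θ θ' x)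
      (norm_selector_sub_le hX hδ g _ _ x)) A hA
  have hn' : (0 : ℝ) < n := by exact_mod_cast hn
  have hσ' : (0 : ℝ) < σ := by exact_mod_cast hσ
  rw [div_mul_div_comm, ← mul_div_assoc, div_le_iff₀ (by positivity)]
  rw [← mul_div_assoc, le_div_iff₀ (by positivity)] at key
  have key' := mul_le_mul_of_nonneg_right key (show 0 ≤ (n : ℝ) * s ^ 2 by positivity)
  -- The multiple of `hδη` is a difference of squares, replacing `(δ n s)²` by `(5η/2)²`; the
  -- constant is `9/50 / 25 = 9/1250`.
  linear_combination key' / 25 + 4 / 25 * T * (1 + n * s ^ 2) * (δ * (n * s) + 5 / 2 * η) * hδη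

theorem le_complexity_sog (hX : Convex ℝ X) (hs : 0 < s) (hsX : cube n s ⊆ X) (hn : 0 < n)
    (hσ : 0 < σ) (hr : 1 ≤ r) (hε : 0 < ε) (h : ε ≤ (s * √((n : ℝ) / 8)) ^ r)
    (g : SubgradientSelector X) :
    ENNReal.ofReal (9 / 1250 * ((n : ℝ) ^ 2 * s ^ 2 * ((σ : ℝ) ^ 2 / ε ^ (2 / r)))) ≤
      (complexity (lipClass X) (sogOracle g σ) r ε : ℝ≥0∞) := by
  have hr0 : 0 < r := by linarith
  obtain ⟨η, hη, rfl, hηs, hη2⟩ := exists_rpow_eq hr0 hε (by positivity) h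
  obtain ⟨δ, hδ, hδη⟩ := exists_slope hs hη hn hηs
  rw [hη2]
  refine ofReal_le_complexity fun T A hA => ?_
  have key := le_horizon_mul hX hδ hs hη hr hsX hn hδη (sogOracle g σ)
    (fun θ θ' x => SqDominated.sogOracle g hσ.ne' x (norm_selector_sub_le hX hδ g _ _ x)) A hA
  have hn' : (0 : ℝ) < n := by exact_mod_cast hn
  have hσ' : (0 : ℝ) < σ := by exact_mod_cast hσ
  rw [← mul_div_assoc, ← mul_div_assoc, div_le_iff₀ (by positivity)]
  rw [← mul_div_assoc, le_div_iff₀ (by positivity)] at key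
  have key' := mul_le_mul_of_nonneg_right key (show 0 ≤ (n : ℝ) * s ^ 2 by positivity)
  linear_combination key' / 25 + 4 / 25 * T * (δ * (n * s) + 5 / 2 * η) * hδη

end LowerBound

/-! ### The cube and the Euclidean ball -/

theorem convex_cube (n : ℕ) (ρ : ℝ) : Convex ℝ (cube n ρ) := by
  intro x hx y hy a b ha hb hab i
  have h := convex_Icc (-ρ) ρ (abs_le.1 (hx i)) (abs_le.1 (hy i)) ha hb hab
  simpa using abs_le.2 h

theorem convex_euclBall (n : ℕ) (ρ : ℝ) : Convex ℝ (euclBall n ρ) := by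
  have : euclBall n ρ = Metric.closedBall 0 ρ := Set.ext fun _ => mem_closedBall_zero_iff.symm
  rw [this]
  exact convex_closedBall _ _

theorem cubeRadius_cube_le {n : ℕ} (hn : 0 < n) {ρ : ℝ} (hρ : 0 ≤ ρ) :
    cubeRadius (cube n ρ) ≤ ρ := by
  refine Real.sSup_le ?_ hρ
  rintro s ⟨hs, h⟩
  have := h (cubeVertex_mem hs fun _ => true) ⟨0, hn⟩
  rwa [abs_cubeVertex hs] at this

theorem norm_cubeVertex {n : ℕ} {s : ℝ} (hs : 0 ≤ s) (θ : Fin n → Bool) :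
    ‖cubeVertex s θ‖ = √n * s := by
  rw [EuclideanSpace.norm_eq]
  simp [abs_cubeVertex hs, Real.sqrt_sq hs]

theorem cubeRadius_euclBall_le {n : ℕ} (hn : 0 < n) {ρ : ℝ} (hρ : 0 ≤ ρ) :
    cubeRadius (euclBall n ρ) ≤ ρ / √n := by
  refine Real.sSup_le ?_ (by positivity)
  rintro s ⟨hs, h⟩
  have h' : ‖_‖ ≤ ρ := h (cubeVertex_mem hs fun _ => true)
  rw [norm_cubeVertex hs] at h'
  rwa [le_div_iff₀ (by positivity), mul_comm]

theorem cube_subset_euclBall {n : ℕ} (hn : 0 < n) {ρ : ℝ} (hρ : 0 ≤ ρ) :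
    cube n (ρ / √n) ⊆ euclBall n ρ := by
  intro x hx
  have hn' : (0 : ℝ) < n := by exact_mod_cast hn
  change ‖x‖ ≤ ρ
  rw [EuclideanSpace.norm_eq]
  apply Real.sqrt_le_iff.2 ⟨hρ, ?_⟩
  calc ∑ i, ‖x i‖ ^ 2 ≤ ∑ _i : Fin n, (ρ / √n) ^ 2 := by
        gcongr with i
        exact hx i
    _ = ρ ^ 2 := by
        simp only [Finset.sum_const, Finset.card_univ, Fintype.card_fin, nsmul_eq_mul]
        rw [div_pow, Real.sq_sqrt hn'.le]
        field_simp

theorem mainTheorem9 :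
    ∃ c : ℝ, 0 < c ∧
      ∀ (n : ℕ) (ρ r ε : ℝ) (σ : ℝ≥0), 16 ≤ n → 0 < ρ → 0 < σ → 1 ≤ r → 0 < ε →
        (ε ≤ (cubeRadius (cube n ρ) * √((n : ℝ) / 8)) ^ r →
          ∀ g : SubgradientSelector (cube n ρ),
            ENNReal.ofReal (c * ((n : ℝ) ^ 2 * ρ ^ 2 / (1 + n * ρ ^ 2) *
                ((σ : ℝ) ^ 2 / ε ^ (2 / r)))) ≤
              (complexity (lipClass (cube n ρ)) (fogOracle g σ) r ε : ℝ≥0∞) ∧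
            ENNReal.ofReal (c * ((n : ℝ) ^ 2 * ρ ^ 2 * ((σ : ℝ) ^ 2 / ε ^ (2 / r)))) ≤
              (complexity (lipClass (cube n ρ)) (sogOracle g σ) r ε : ℝ≥0∞)) ∧
        (ε ≤ (cubeRadius (euclBall n ρ) * √((n : ℝ) / 8)) ^ r →
          ∀ g : SubgradientSelector (euclBall n ρ),
            ENNReal.ofReal (c * ((n : ℝ) * ρ ^ 2 / (1 + ρ ^ 2) *
                ((σ : ℝ) ^ 2 / ε ^ (2 / r)))) ≤
              (complexity (lipClass (euclBall n ρ)) (fogOracle g σ) r ε : ℝ≥0∞) ∧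
            ENNReal.ofReal (c * ((n : ℝ) * ρ ^ 2 * ((σ : ℝ) ^ 2 / ε ^ (2 / r)))) ≤
              (complexity (lipClass (euclBall n ρ)) (sogOracle g σ) r ε : ℝ≥0∞)) := by
  refine ⟨9 / 1250, by norm_num, fun n ρ r ε σ hn hρ hσ hr hε => ⟨fun h g => ?_, fun h g => ?_⟩⟩
  all_goals
    have hn0 : 0 < n := by omega
    have hn' : (0 : ℝ) < n := by exact_mod_cast hn0
    have hr0 : 0 ≤ r := by linarith
    have hrad : ∀ X : Set (EuclideanSpace ℝ (Fin n)), 0 ≤ cubeRadius X := fun X =>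
      Real.sSup_nonneg fun s hs => hs.1
  -- Only the upper bound on `cubeRadius` is needed, because it enlarges the admissible range of
  -- `ε`.
  · have h' := h.trans (Real.rpow_le_rpow (mul_nonneg (hrad _) (Real.sqrt_nonneg _))
      (mul_le_mul_of_nonneg_right (cubeRadius_cube_le hn0 hρ.le) (Real.sqrt_nonneg _)) hr0)
    exact ⟨le_complexity_fog (convex_cube n ρ) hρ subset_rfl hn0 hσ hr hε h' g,
      le_complexity_sog (convex_cube n ρ) hρ subset_rfl hn0 hσ hr hε h' g⟩
  · have h' := h.trans (Real.rpow_le_rpow (mul_nonneg (hrad _) (Real.sqrt_nonneg _))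
      (mul_le_mul_of_nonneg_right (cubeRadius_euclBall_le hn0 hρ.le) (Real.sqrt_nonneg _)) hr0)
    -- The ball contains the cube of radius `s = ρ / √n`, for which `n s² = ρ²` and `n² s² = n ρ²`.
    have hs : 0 < ρ / √n := by positivity
    have e₁ : (n : ℝ) * (ρ / √n) ^ 2 = ρ ^ 2 := by
      rw [div_pow, Real.sq_sqrt hn'.le]
      field_simp
    have e₂ : (n : ℝ) ^ 2 * (ρ / √n) ^ 2 = n * ρ ^ 2 := by
      rw [← e₁]
      ring
    have hfog := le_complexity_fog (convex_euclBall n ρ) hs (cube_subset_euclBall hn0 hρ.le) hn0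
      hσ hr hε h' g
    have hsog := le_complexity_sog (convex_euclBall n ρ) hs (cube_subset_euclBall hn0 hρ.le) hn0
      hσ hr hε h' g
    rw [e₂] at hfog hsog
    rw [e₁] at hfog
    exact ⟨hfog, hsog⟩
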